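/- **Proposition (Identifying Observed Parent-Cause Set).** Consider a stationary multivariate Hawkes process with finitely many subprocesses $N_i$, of which $O_1,\dots,O_p$ are observed and the others (possibly none) are latent, with background intensities $\mu_i\ge 0$ and piecewise continuous excitation functions $\phi_{ij}\ge 0$ on $(0,\infty)$ such that $\big(\int_0^\infty\phi_{ij}\big)_{ij}$ is finite with spectral radius less than one. Its *summary graph* has an edge $N_j\to N_i$ iff $\phi_{ij}$ is not (almost everywhere) zero. The *parent-cause set* of $N_i$ is the minimal set of subprocesses other than $N_i$ that meets (end points included) every directed path from a subprocess other than $N_i$ to $N_i$, with $N_i$ added if it has a self-loop. Fix a bin width $\Delta>0$ and put $\theta_{ij}^{(k)}=\int_{(k-1)\Delta}^{k\Delta}\phi_{ij}(s)\,ds$ for $k\ge 1$. Let the discretized process be described by its linear autoregressive model: square-integrable variables with $N_i^{(0)}=0$ and $$N_i^{(n)}=\sum_j\sum_{k=1}^{n}\theta_{ij}^{(k)}N_j^{(n-k)}+\varepsilon_i^{(n)}+\Delta\mu_i\qquad(n\ge 1),$$ where the $\varepsilon_i^{(n)}$ are centred, have positive variance, and are pairwise uncorrelated (over time and across subprocesses).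 The *window graph* is the directed acyclic graph on the variables $N_i^{(t)}$, $t\ge0$, with an edge $N_j^{(t-k)}\to N_i^{(t)}$, $1\le k\le t$, iff $\theta_{ij}^{(k)}\neq0$. Let $m$ be at least the number of effective lags, i.e. $\theta_{ij}^{(k)}=0$ for all $i,j$ and $k>m$, and let $n>m$. Put $\mathbf O_v=\{O_i^{(j)}: 1\le i\le p,\ n-m\le j\le n\}$ and, for a set $\mathcal P$ of observed subprocesses, $\mathbf P_v=\{O_i^{(j)}: O_i\in\mathcal P,\ n-m\le j\le n-1\}$. Let $O_1$ be any observed subprocess, and consider the following statements about $\mathcal P$, where minimality is with respect to inclusion among sets of observed subprocesses. 1. $\mathcal P$ is the parent-cause set of $O_1$ in the summary graph. 2. $\mathcal P$ is minimal such that $\mathbf P_v$ contains all parents of $O_1^{(n)}$ in the window graph. 3. $\mathcal P$ is minimal such that $\mathbf P_v$ d-separates $O_1^{(n)}$ from $\mathbf O_v\setminus(\mathbf P_v\cup\{O_1^{(n)}\})$ in the window graph. 4. $\mathcal P$ is minimal such that $\operatorname{rank}\big(\Sigma_{\{O_1^{(n)}\}\cup\mathbf P_v,\ \mathbf O_v\setminus\{O_1^{(n)}\}}\big)=|\mathbf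 P_v|$, where $\Sigma_{\mathbf A,\mathbf B}$ is the cross-covariance matrix of $\mathbf A$ and $\mathbf B$. Then (1) and (2) are always equivalent and imply (3) and (4). If no latent subprocess has an edge to $O_1$ in the summary graph (in particular if all subprocesses are observed), then (1), (2), (3) and (4) are equivalent. -/

import Mathlib

namespace Hawkes

/-! ### Directed graphs: parent-cause sets and d-separation -/

section Graph

variable {V : Type*}

/-- `π` is a directed path from `u` to `v` (all its vertices, end points included, listed in
order). -/
def IsDirectedPath (E : V → V → Prop) (u v : V) (π : List V) : Prop :=
  π.IsChain E ∧ π.Nodup ∧ π.head? = some u ∧ π.getLast? = some v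

/-- `S` does not contain `v`, and every directed path to `v` from a node other than `v` passes
through some node of `S`. -/
def BlocksPathsTo (E : V → V → Prop) (v : V) (S : Set V) : Prop :=
  v ∉ S ∧ ∀ u, u ≠ v → ∀ π : List V, IsDirectedPath E u v π → ∃ x ∈ π, x ∈ S

/-- `P` is the parent-cause set of `v`: a minimal set blocking the directed paths to `v`, to
which `v` itself is added when it has a self-loop. -/
def IsParentCauseSet (E : V → V → Prop) (v : V) (P : Set V) : Prop :=
  ∃ S : Set V, Minimal (BlocksPathsTo E v) S ∧ P = S ∪ {x | x = v ∧ E v v}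

/-- `π` is a path from `u` to `v` in the underlying undirected graph. -/
def IsTrail (E : V → V → Prop) (u v : V) (π : List V) : Prop :=
  π.IsChain (fun a b => E a b ∨ E b a) ∧ π.Nodup ∧ π.head? = some u ∧ π.getLast? = some v

/-- The path `π` is active (not blocked) given `C`: every collider on it has a descendant
(possibly itself) in `C`, and no interior non-collider lies in `C`. -/
def IsActive (E : V → V → Prop) (C : Set V) (π : List V) : Prop :=
  ∀ a b c : V, [a, b, c] <:+: π →
    ((E a b ∧ E c b) → ∃ d ∈ C, Relation.ReflTransGen E b d) ∧
    (¬ (E a b ∧ E c b) → b ∉ C)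

/-- `C` d-separates `A` from `B` (for pairwise disjoint `A`, `B`, `C` in a directed acyclic
graph): no path between them is active given `C`. -/
def DSep (E : V → V → Prop) (A B C : Set V) : Prop :=
  ∀ a ∈ A, ∀ b ∈ B, ∀ π : List V, IsTrail E a b π → ¬ IsActive E C π

end Graph

/-! ### The model -/

/-- Subprocesses: `p` observed ones (`Sum.inl`) and `q` latent ones (`Sum.inr`). -/
abbrev Subprocess (p q : ℕ) : Type := Fin p ⊕ Fin q

/-- A variable of the discretized process: a subprocess and the index of a time bin. -/
abbrev Node (p q : ℕ) : Type := Subprocess p q × ℕ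

/-- The parameters of a stationary, partially observed multivariate Hawkes process with
intensities `λ_i(t) = μ_i + ∑ j, ∫_0^t φ_ij(t - s) dN_j(s)`. Thus `phi i j` is the influence of
subprocess `j` on subprocess `i`. -/
structure Model (p q : ℕ) where
  mu : Subprocess p q → ℝ
  phi : Subprocess p q → Subprocess p q → ℝ → ℝ
  mu_nonneg : ∀ i, 0 ≤ mu i
  phi_nonneg : ∀ i j s, 0 < s → 0 ≤ phi i j s
  phi_piecewise_continuous : ∀ i j (T : ℝ),
    {s : ℝ | 0 < s ∧ s ≤ T ∧ ¬ ContinuousAt (phi i j) s}.Finite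
  phi_integrable : ∀ i j, MeasureTheory.IntegrableOn (phi i j) (Set.Ioi 0)
  stationary : spectralRadius ℂ
    (Matrix.of fun i j => ((∫ s in Set.Ioi (0 : ℝ), phi i j s : ℝ) : ℂ)) < 1

namespace Model

variable {p q : ℕ} (M : Model p q)

/-- Summary graph: there is an edge `j → i` when the excitation function `φ_ij` is nonzero
(as an integrable function, that is, not almost everywhere zero on `(0, ∞)`). -/
def SummaryEdge (j i : Subprocess p q) : Prop :=
  ¬ (M.phi i j =ᵐ[MeasureTheory.volume.restrict (Set.Ioi 0)] 0)

/-- The excitation coefficient `θ_ij^(k)`, `k ≥ 1`, for bins of width `Δ`. -/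
noncomputable def theta (Δ : ℝ) (i j : Subprocess p q) (k : ℕ) : ℝ :=
  ∫ s in (((k : ℝ) - 1) * Δ)..((k : ℝ) * Δ), M.phi i j s

/-- Window graph: there is an edge `N_j^(s) → N_i^(t)` when `s < t` and the coefficient of
`N_j^(s)` in the equation of `N_i^(t)` is nonzero. -/
def WindowEdge (Δ : ℝ) (u v : Node p q) : Prop :=
  u.2 < v.2 ∧ M.theta Δ v.1 u.1 (v.2 - u.2) ≠ 0

/-- The number of effective lags is at most `m`: all coefficients of larger lag vanish. -/
def EffectiveLagsLE (Δ : ℝ) (m : ℕ) : Prop :=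
  ∀ i j k, m < k → M.theta Δ i j k = 0

variable {Ω : Type*} [MeasurableSpace Ω]

/-- The residual
`ε_i^(n) = N_i^(n) - ∑ j, ∑ k ∈ {1, …, n}, θ_ij^(k) N_j^(n-k) - Δ μ_i`. -/
noncomputable def noise (Δ : ℝ) (N : Node p q → Ω → ℝ) (v : Node p q) (ω : Ω) : ℝ :=
  N v ω - (∑ j : Subprocess p q, ∑ k ∈ Finset.Icc 1 v.2,
    M.theta Δ v.1 j k * N (j, v.2 - k) ω) - Δ * M.mu v.1

/-- `N` is a discretized process with bin width `Δ`: the square integrable variables `N_i^(n)`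
satisfy `N_i^(0) = 0` and, for `n ≥ 1`, the linear autoregressive equation
`N_i^(n) = ∑ j, ∑ k ∈ {1, …, n}, θ_ij^(k) N_j^(n-k) + ε_i^(n) + Δ μ_i`
with nondegenerate centred noise, uncorrelated over time and across subprocesses. -/
structure IsDiscretized (Δ : ℝ) (N : Node p q → Ω → ℝ) (ℙ : MeasureTheory.Measure Ω) :
    Prop where
  initial : ∀ i, N (i, 0) =ᵐ[ℙ] 0
  memLp : ∀ v, MeasureTheory.MemLp (N v) 2 ℙ
  noise_mean : ∀ v : Node p q, 1 ≤ v.2 → ∫ ω, M.noise Δ N v ω ∂ℙ = 0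
  noise_variance : ∀ v : Node p q, 1 ≤ v.2 → 0 < ProbabilityTheory.variance (M.noise Δ N v) ℙ
  noise_uncorrelated : ∀ u v : Node p q, 1 ≤ u.2 → 1 ≤ v.2 → u ≠ v →
    ProbabilityTheory.covariance (M.noise Δ N u) (M.noise Δ N v) ℙ = 0

end Model

/-! ### Observed variables and the four statements -/

section Statements

variable {p q : ℕ}

/-- The observed window variables `O_i^(j)`, `i` observed, `n - m ≤ j ≤ n`. -/
def obsVars (p q n m : ℕ) : Finset (Node p q) :=
  ((Finset.univ : Finset (Fin p)) ×ˢ Finset.Icc (n - m) n).image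
    fun x => (Sum.inl x.1, x.2)

/-- The lagged variables `O_i^(j)`, `i ∈ P`, `n - m ≤ j ≤ n - 1`. -/
def lagVars (q n m : ℕ) (P : Finset (Fin p)) : Finset (Node p q) :=
  (P ×ˢ Finset.Ico (n - m) n).image fun x => (Sum.inl x.1, x.2)

/-- The cross-covariance matrix of the families of variables `A` and `B`. -/
noncomputable def crossCov {Ω : Type*} [MeasurableSpace Ω] (N : Node p q → Ω → ℝ)
    (ℙ : MeasureTheory.Measure Ω) (A B : Finset (Node p q)) : Matrix A B ℝ :=
  Matrix.of fun a b => ProbabilityTheory.covariance (N a) (N b) ℙ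

variable (M : Model p q) (Δ : ℝ) (n m : ℕ) (o : Fin p)

/-- `P` is the parent-cause set of the observed subprocess `o` in the summary graph. -/
def IsSummaryParentCauseSet (P : Finset (Fin p)) : Prop :=
  IsParentCauseSet M.SummaryEdge (Sum.inl o) (Sum.inl '' (P : Set (Fin p)))

/-- The lagged variables of `P` contain all window graph parents of `o^(n)`. -/
def ContainsWindowParents (P : Finset (Fin p)) : Prop :=
  ∀ u : Node p q, M.WindowEdge Δ u (Sum.inl o, n) → u ∈ lagVars q n m P

/-- The lagged variables of `P` d-separate `o^(n)` from the remaining observed variables. -/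
def LagsDSeparate (P : Finset (Fin p)) : Prop :=
  DSep (M.WindowEdge Δ) {((Sum.inl o, n) : Node p q)}
    (↑(obsVars p q n m \ insert (Sum.inl o, n) (lagVars q n m P)) : Set (Node p q))
    (↑(lagVars q n m P) : Set (Node p q))

/-- The rank condition for the lagged variables of `P`. -/
def RankCondition {Ω : Type*} [MeasurableSpace Ω] (N : Node p q → Ω → ℝ)
    (ℙ : MeasureTheory.Measure Ω) (P : Finset (Fin p)) : Prop :=
  (crossCov N ℙ (insert (Sum.inl o, n) (lagVars q n m P))
    ((obsVars p q n m).erase (Sum.inl o, n))).rank = (lagVars q n m P).card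

end Statements

end Hawkes

/-! All four statements say that the set is least among those containing the parents of `O_1`. A
parent-cause set is just the set of parents: every directed path ends with an edge into the target,
and each such edge is itself a path. As `φ ≥ 0`, a summary edge exists iff some `θ^(k)` is nonzero,
so summary parents are exactly the subprocesses of window parents (`containsWindowParents_iff`).

When all parents are observed, d-separation and the rank condition each amount to containing the
parents. For d-separation, a missing parent is adjacent to `O_1^(n)`; conversely, conditioning on a
past that includes all parents blocks every path to nodes that are not later. For the rank, the
covariance row of `O_1^(n)` is the combination of its parents' rows with coefficients `θ`, because
its noise is uncorrelated with the other window variables. The rows of those variables are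
independent (`linearIndepOn_covariance`), so this combination lies in the span of the lagged rows
iff they include every parent. -/

namespace Hawkes

open MeasureTheory ProbabilityTheory

/-! ### Blocking sets and d-separation in a time-ordered graph -/

section Graph

variable {V : Type*} {E : V → V → Prop}

/-- The nodes other than `v` with an edge to `v` are the least set blocking all paths to `v`. -/
lemma minimal_blocksPathsTo_iff {v : V} {S : Set V} :
    Minimal (BlocksPathsTo E v) S ↔ S = {u | u ≠ v ∧ E u v} := by
  have hblock : BlocksPathsTo E v {u | u ≠ v ∧ E u v} := by
    refine ⟨fun h => h.1 rfl, fun u hu π ⟨hc, hnd, hh, hl⟩ => ?_⟩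
    obtain ⟨l, rfl⟩ := List.getLast?_eq_some_iff.1 hl
    rcases List.eq_nil_or_concat l with rfl | ⟨l, x, rfl⟩
    · simp at hh
      exact absurd hh.symm hu
    · refine ⟨x, by simp, ?_, ?_⟩
      · rintro rfl
        simp [List.nodup_append] at hnd
      · simp only [List.append_assoc, List.concat_eq_append] at hc
        have := hc.right_of_append
        simpa using this
  have hleast : ∀ T, BlocksPathsTo E v T → {u | u ≠ v ∧ E u v} ⊆ T := by
    rintro T ⟨hv, hT⟩ u ⟨hu, he⟩
    obtain ⟨x, hx, hxT⟩ := hT u hu [u, v] ⟨by simpa using he, by simpa using hu, rfl, rfl⟩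
    simp only [List.mem_cons, List.not_mem_nil, or_false] at hx
    rcases hx with rfl | rfl
    · exact hxT
    · exact absurd hxT hv
  constructor
  · intro h
    exact (hleast S h.prop).antisymm' (h.le_of_le hblock (hleast S h.prop))
  · rintro rfl
    exact ⟨hblock, fun T hT _ => hleast T hT⟩

/-- The parent-cause set is the set of parents. -/
lemma isParentCauseSet_iff {v : V} {P : Set V} :
    IsParentCauseSet E v P ↔ P = {u | E u v} := by
  have key : {u | u ≠ v ∧ E u v} ∪ {x | x = v ∧ E v v} = {u | E u v} := by
    ext u
    by_cases h : u = v
    · subst h; simp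
    · simp [h]
  simp only [IsParentCauseSet, minimal_blocksPathsTo_iff, exists_eq_left, key]

/-- An active path whose first edge points forward in time can never turn back when the
conditioning set lies in the past. -/
lemma lt_getLast_of_isActive {τ : V → ℕ} (hτ : ∀ u v, E u v → τ u < τ v) {C : Set V}
    {z : V} (l : List V) : ∀ a b : V, (∀ d ∈ C, τ d ≤ τ a) → E a b →
      (a :: b :: l).IsChain (fun x y => E x y ∨ E y x) → IsActive E C (a :: b :: l) →
      (a :: b :: l).getLast? = some z → τ a < τ z := by
  induction l with
  | nil =>
    intro a b _ hab _ _ hz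
    simp at hz
    exact hz ▸ hτ _ _ hab
  | cons c l ih =>
    intro a b hC hab hch hact hz
    have hlt := hτ _ _ hab
    have hchain : (b :: c :: l).IsChain (fun x y => E x y ∨ E y x) := hch.tail
    -- Otherwise `b` is a collider, and its descendants are all later than `a`, hence outside `C`.
    have hbc : E b c := by
      rcases (List.isChain_cons_cons.1 hchain).1 with h | h
      · exact h
      · obtain ⟨d, hd, hbd⟩ := (hact a b c ⟨[], l, rfl⟩).1 ⟨hab, h⟩
        have hle : τ b ≤ τ d := by
          clear hd
          induction hbd with
          | refl => exact le_rfl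
          | tail _ h ih => exact ih.trans (hτ _ _ h).le
        have := hC d hd
        omega
    refine hlt.trans (ih b c (fun d hd => (hC d hd).trans hlt.le) hbc hchain ?_ ?_)
    · exact fun x y w hxy => hact x y w (List.infix_cons hxy)
    · rwa [List.getLast?_cons_cons] at hz

/-- If the conditioning set lies in the past of `v` and contains all parents of `v`, it
d-separates `v` from all other nodes that are not later than `v`. -/
lemma dsep_of_parents_subset {τ : V → ℕ} (hτ : ∀ u v, E u v → τ u < τ v) {v : V}
    {B C : Set V} (hC : ∀ d ∈ C, τ d ≤ τ v) (hpar : ∀ u, E u v → u ∈ C)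
    (hB : ∀ b ∈ B, b ≠ v ∧ b ∉ C ∧ τ b ≤ τ v) : DSep E {v} B C := by
  rintro a rfl b hb π ⟨hch, -, hh, hl⟩ hact
  obtain ⟨hbv, hbC, hbτ⟩ := hB b hb
  match π, hh with
  | [x], hh =>
    simp at hh hl
    exact hbv (hl.symm.trans hh)
  | x :: y :: l, hh =>
    obtain rfl : x = a := by simpa using hh
    rcases (List.isChain_cons_cons.1 hch).1 with h | h
    · exact absurd (lt_getLast_of_isActive hτ l x y hC h hch hact hl) hbτ.not_gt
    · cases l with
      | nil =>
        obtain rfl : y = b := by simpa using hl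
        exact hbC (hpar _ h)
      | cons w l =>
        -- The edge points from `y` to `x`, so by time order `y` is no collider, and it lies in `C`.
        refine (hact x y w ⟨[], l, rfl⟩).2 ?_ (hpar _ h)
        rintro ⟨h', -⟩
        exact absurd (hτ _ _ h) (hτ _ _ h').not_gt

/-- d-separated nodes are not adjacent. -/
lemma DSep.not_edge {A B C : Set V} (h : DSep E A B C) {a b : V} (ha : a ∈ A) (hb : b ∈ B)
    (hne : a ≠ b) : ¬ E b a := by
  intro he
  refine h a ha b hb [a, b] ⟨by simpa using Or.inr he, by simpa using hne, rfl, rfl⟩ ?_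
  -- A two-vertex path has no interior vertex, so it is active vacuously.
  intro x y z hxyz
  have := hxyz.length_le
  simp at this

end Graph

/-! ### Linear algebra of ranks and spans -/

section Rank

open Submodule in
/-- Appending a row to linearly independent rows keeps the rank iff the new row lies in their
span. -/
lemma rank_insert_eq_card_iff {ι κ : Type*} [DecidableEq ι] [Fintype κ] (f : ι → κ → ℝ)
    {S : Finset ι} (a : ι) (hS : LinearIndepOn ℝ f (S : Set ι)) :
    (Matrix.of fun (x : ↥(insert a S)) b => f x b).rank = S.card ↔
      f a ∈ span ℝ (f '' (S : Set ι)) := by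
  have hrow : Set.range (Matrix.of fun (x : ↥(insert a S)) b => f x b).row
      = insert (f a) (f '' (S : Set ι)) := by
    rw [← Set.image_insert_eq, ← Finset.coe_insert, Set.image_eq_range]
    rfl
  have hcard : Module.finrank ℝ (span ℝ (f '' (S : Set ι))) = S.card := by
    have h := finrank_span_eq_card hS
    rw [Set.image_eq_range]
    simpa using h
  rw [Matrix.rank_eq_finrank_span_row, hrow, ← hcard]
  constructor
  · intro h
    rw [eq_of_le_of_finrank_eq (span_mono (Set.subset_insert (f a) _)) h.symm]
    exact subset_span (Set.mem_insert _ _)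
  · intro h
    rw [span_insert_eq_span h]

/-- A linear combination of linearly independent vectors lies in the span of a subfamily iff
all other coefficients vanish. -/
lemma sum_smul_mem_span_image_iff {ι W : Type*} [AddCommGroup W] [Module ℝ W] [DecidableEq ι]
    {f : ι → W} {B S : Finset ι} (hSB : S ⊆ B) (hB : LinearIndepOn ℝ f (B : Set ι))
    (c : ι → ℝ) :
    ∑ u ∈ B, c u • f u ∈ Submodule.span ℝ (f '' (S : Set ι)) ↔ ∀ u ∈ B, c u ≠ 0 → u ∈ S := by
  constructor
  · intro h u hu hcu
    obtain ⟨d, hd⟩ := Submodule.mem_span_image_finset_iff_exists_fun' ℝ |>.1 h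
    by_contra huS
    have hsum : ∑ x ∈ B, (c x - if x ∈ S then d x else 0) • f x = 0 := by
      simp only [sub_smul, Finset.sum_sub_distrib, ite_smul, zero_smul, ← Finset.sum_filter]
      rw [Finset.filter_mem_eq_inter, Finset.inter_eq_right.2 hSB, hd, sub_self]
    have := linearIndepOn_finset_iff.1 hB _ hsum u hu
    simp [huS] at this
    exact hcu this
  · intro h
    refine Submodule.sum_mem _ fun u hu => ?_
    by_cases hcu : c u = 0
    · simp [hcu]
    · exact Submodule.smul_mem _ _ (Submodule.subset_span ⟨u, h u hu hcu, rfl⟩)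

end Rank

/-! ### Degenerate variables -/

section Covariance

variable {Ω : Type*} [MeasurableSpace Ω] {μ : Measure Ω}

/-- A square integrable variable of variance zero is uncorrelated with every variable. -/
lemma covariance_eq_zero_of_variance_eq_zero [IsFiniteMeasure μ] {X Y : Ω → ℝ} (hX : MemLp X 2 μ)
    (h : Var[X; μ] = 0) : cov[X, Y; μ] = 0 := by
  have := ae_eq_integral_of_variance_eq_zero hX h
  rw [covariance]
  refine integral_eq_zero_of_ae ?_
  filter_upwards [this] with ω hω
  simp [hω]

/-- A variable that vanishes almost surely is uncorrelated with every variable. -/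
lemma covariance_eq_zero_of_ae_eq_zero {X Y : Ω → ℝ} (h : X =ᵐ[μ] 0) : cov[X, Y; μ] = 0 := by
  rw [covariance, integral_congr_ae h]
  refine integral_eq_zero_of_ae ?_
  filter_upwards [h] with ω hω
  simp [hω]

end Covariance

/-! ### Summary edges versus window edges -/

namespace Model

variable {p q : ℕ} {M : Model p q} {Δ : ℝ}

lemma windowEdge_time_lt {u v : Node p q} (h : M.WindowEdge Δ u v) : u.2 < v.2 := h.1

/-- The excitation function vanishes almost everywhere iff all coefficients vanish. -/
lemma summaryEdge_iff (hΔ : 0 < Δ) (i j : Subprocess p q) :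
    M.SummaryEdge j i ↔ ∃ k, 1 ≤ k ∧ M.theta Δ i j k ≠ 0 := by
  have hset : ∀ k : ℕ, 1 ≤ k →
      (M.theta Δ i j k = 0 ↔
        M.phi i j =ᵐ[volume.restrict (Set.Ioc (((k : ℝ) - 1) * Δ) (k * Δ))] 0) := by
    intro k hk
    have hk' : (1 : ℝ) ≤ k := by exact_mod_cast hk
    have hsub : Set.Ioc (((k : ℝ) - 1) * Δ) (k * Δ) ⊆ Set.Ioi 0 := fun s hs =>
      lt_of_le_of_lt (mul_nonneg (by linarith) hΔ.le) hs.1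
    rw [theta, intervalIntegral.integral_of_le (by nlinarith)]
    refine setIntegral_eq_zero_iff_of_nonneg_ae ?_ ((M.phi_integrable i j).mono_set hsub)
    filter_upwards [ae_restrict_mem measurableSet_Ioc] with s hs
    exact M.phi_nonneg i j s (hsub hs)
  -- The shift by one leaves out lag 0, whose bin would be `(-Δ, 0]`.
  have hunion : (⋃ k : ℕ, Set.Ioc ((((k + 1 : ℕ) : ℝ) - 1) * Δ) (((k + 1 : ℕ) : ℝ) * Δ))
      = Set.Ioi 0 := by
    ext s
    simp only [Set.mem_iUnion, Set.mem_Ioc, Set.mem_Ioi, Nat.cast_add, Nat.cast_one,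
      add_sub_cancel_right]
    constructor
    · rintro ⟨k, hk, -⟩
      exact lt_of_le_of_lt (by positivity) hk
    · intro hs
      have hpos : 0 < ⌈s / Δ⌉₊ := Nat.ceil_pos.2 (by positivity)
      refine ⟨⌈s / Δ⌉₊ - 1, ?_, ?_⟩
      · rw [← lt_div_iff₀ hΔ]
        exact Nat.lt_ceil.1 (by omega)
      · rw [← div_le_iff₀ hΔ]
        have : ((⌈s / Δ⌉₊ - 1 : ℕ) : ℝ) + 1 = ⌈s / Δ⌉₊ := by
          exact_mod_cast Nat.sub_add_cancel hpos
        rw [this]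
        exact Nat.le_ceil _
  rw [SummaryEdge, not_iff_comm]
  push Not
  rw [← hunion, Filter.EventuallyEq, ae_restrict_iUnion_iff]
  constructor
  · intro h k
    exact (hset (k + 1) (by omega)).1 (h _ (by omega))
  · intro h k hk
    obtain ⟨k, rfl⟩ := Nat.exists_eq_add_of_le' hk
    exact (hset (k + 1) hk).2 (h k)

/-- The window graph is the summary graph unrolled over the effective lags. -/
lemma summaryEdge_iff_windowEdge (hΔ : 0 < Δ) {m n : ℕ} (hm : M.EffectiveLagsLE Δ m)
    (hn : m < n) (i j : Subprocess p q) :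
    M.SummaryEdge j i ↔ ∃ t, M.WindowEdge Δ (j, t) (i, n) := by
  rw [summaryEdge_iff hΔ]
  constructor
  · rintro ⟨k, hk, hθ⟩
    have hkm : k ≤ m := by
      by_contra h
      exact hθ (hm i j k (by omega))
    refine ⟨n - k, by simp only; omega, ?_⟩
    simpa only [Nat.sub_sub_self (hkm.trans hn.le)] using hθ
  · rintro ⟨t, ht, hθ⟩
    exact ⟨n - t, by simp only at ht; omega, hθ⟩

lemma WindowEdge.time_mem {m n : ℕ} (hm : M.EffectiveLagsLE Δ m) {u : Node p q}
    {i : Subprocess p q} (h : M.WindowEdge Δ u (i, n)) : u.2 ∈ Finset.Ico (n - m) n := by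
  obtain ⟨h1, h2⟩ := h
  have : n - u.2 ≤ m := by
    by_contra h
    exact h2 (hm _ _ _ (by simp only; omega))
  simp only at h1
  simp only [Finset.mem_Ico]
  omega

end Model

/-! ### Parents, lagged variables and d-separation -/

section Windows

variable {p q : ℕ} {M : Model p q} {Δ : ℝ} {m n : ℕ} {o : Fin p} {P : Finset (Fin p)}

lemma mem_lagVars {u : Node p q} :
    u ∈ lagVars q n m P ↔ (∃ i ∈ P, u.1 = Sum.inl i) ∧ u.2 ∈ Finset.Ico (n - m) n := by
  obtain ⟨j, t⟩ := u
  simp only [lagVars, Finset.mem_image, Finset.mem_product, Prod.exists, Prod.mk.injEq]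
  constructor
  · rintro ⟨i, s, ⟨hi, hs⟩, rfl, rfl⟩
    exact ⟨⟨i, hi, rfl⟩, hs⟩
  · rintro ⟨⟨i, hi, rfl⟩, hs⟩
    exact ⟨i, t, ⟨hi, hs⟩, rfl, rfl⟩

lemma mem_obsVars {u : Node p q} :
    u ∈ obsVars p q n m ↔ (∃ i, u.1 = Sum.inl i) ∧ u.2 ∈ Finset.Icc (n - m) n := by
  obtain ⟨j, t⟩ := u
  simp only [obsVars, Finset.mem_image, Finset.mem_product, Prod.exists, Prod.mk.injEq]
  constructor
  · rintro ⟨i, s, ⟨-, hs⟩, rfl, rfl⟩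
    exact ⟨⟨i, rfl⟩, hs⟩
  · rintro ⟨⟨i, rfl⟩, hs⟩
    exact ⟨i, t, ⟨Finset.mem_univ _, hs⟩, rfl, rfl⟩

lemma lagVars_subset : lagVars q n m P ⊆ (obsVars p q n m).erase (Sum.inl o, n) := by
  intro u hu
  obtain ⟨⟨i, -, hi⟩, ht⟩ := mem_lagVars.1 hu
  rw [Finset.mem_Ico] at ht
  refine Finset.mem_erase.2 ⟨?_, mem_obsVars.2 ⟨⟨i, hi⟩, Finset.mem_Icc.2 ⟨ht.1, ht.2.le⟩⟩⟩
  rintro rfl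
  exact lt_irrefl _ ht.2

/-- The lagged variables of `P` contain the window graph parents iff `P` contains the summary
graph parents. -/
lemma containsWindowParents_iff (hΔ : 0 < Δ) (hm : M.EffectiveLagsLE Δ m) (hn : m < n) :
    ContainsWindowParents M Δ n m o P ↔
      {u | M.SummaryEdge u (Sum.inl o)} ⊆ Sum.inl '' (P : Set (Fin p)) := by
  constructor
  · intro h j hj
    obtain ⟨t, ht⟩ := (Model.summaryEdge_iff_windowEdge hΔ hm hn _ _).1 hj
    obtain ⟨⟨i, hi, hij⟩, -⟩ := mem_lagVars.1 (h _ ht)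
    exact ⟨i, hi, hij.symm⟩
  · rintro h ⟨j, t⟩ hu
    obtain ⟨i, hi, hij⟩ := h ((Model.summaryEdge_iff_windowEdge hΔ hm hn _ _).2 ⟨t, hu⟩)
    exact mem_lagVars.2 ⟨⟨i, hi, hij.symm⟩, hu.time_mem hm⟩

/-- Containing the parents is an upward closed condition whose least solution is the parent set
itself. If some parent is latent, neither side holds for any `P`. -/
lemma isSummaryParentCauseSet_iff (hΔ : 0 < Δ) (hm : M.EffectiveLagsLE Δ m) (hn : m < n) :
    IsSummaryParentCauseSet M o P ↔ Minimal (ContainsWindowParents M Δ n m o) P := by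
  rw [IsSummaryParentCauseSet, isParentCauseSet_iff]
  constructor
  · intro h
    refine ⟨(containsWindowParents_iff hΔ hm hn).2 h.ge, fun Q hQ _ => ?_⟩
    have := (containsWindowParents_iff hΔ hm hn).1 hQ
    rw [← h, Set.image_subset_image_iff Sum.inl_injective] at this
    exact_mod_cast this
  · intro h
    have hP := (containsWindowParents_iff hΔ hm hn).1 h.prop
    refine subset_antisymm ?_ hP
    rintro _ ⟨i, hi, rfl⟩
    by_contra hE
    have hQ : ContainsWindowParents M Δ n m o (P.erase i) := by
      rw [containsWindowParents_iff hΔ hm hn]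
      intro u hu
      obtain ⟨j, hj, rfl⟩ := hP hu
      refine ⟨j, ?_, rfl⟩
      rw [Finset.mem_coe, Finset.mem_erase]
      exact ⟨fun hji => hE (hji ▸ hu), hj⟩
    exact Finset.notMem_erase i P (h.le_of_le hQ (Finset.erase_subset i P) hi)

/-- A parent outside the lagged variables is observed by `hobs`, so it is one of the nodes to be
separated, yet adjacent to `o^(n)`. The converse does not need `hobs`. -/
lemma lagsDSeparate_iff (hm : M.EffectiveLagsLE Δ m)
    (hobs : ∀ u, M.WindowEdge Δ u (Sum.inl o, n) → ∃ i, u.1 = Sum.inl i) :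
    LagsDSeparate M Δ n m o P ↔ ContainsWindowParents M Δ n m o P := by
  constructor
  · intro h u hu
    by_contra huP
    have htime := Finset.mem_Ico.1 (hu.time_mem hm)
    have hne : ((Sum.inl o, n) : Node p q) ≠ u := fun he => by
      rw [← he] at htime
      exact lt_irrefl _ htime.2
    refine h.not_edge (b := u) rfl ?_ hne hu
    rw [Finset.mem_coe, Finset.mem_sdiff, Finset.mem_insert, not_or]
    exact ⟨mem_obsVars.2 ⟨hobs u hu, Finset.mem_Icc.2 ⟨htime.1, htime.2.le⟩⟩, hne.symm, huP⟩
  · intro h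
    refine dsep_of_parents_subset (τ := Prod.snd) (fun _ _ => Model.windowEdge_time_lt) ?_ h ?_
    · intro d hd
      exact (Finset.mem_Ico.1 (mem_lagVars.1 hd).2).2.le
    · intro b hb
      rw [Finset.mem_coe, Finset.mem_sdiff, Finset.mem_insert, not_or] at hb
      exact ⟨hb.2.1, hb.2.2, (Finset.mem_Icc.1 (mem_obsVars.1 hb.1).2).2⟩

end Windows

/-! ### Covariances of the autoregressive process -/

namespace Model.IsDiscretized

variable {p q : ℕ} {M : Model p q} {Δ : ℝ} {Ω : Type*} [MeasurableSpace Ω] {μ : Measure Ω}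
  {N : Node p q → Ω → ℝ}

lemma memLp_lagSum (hN : M.IsDiscretized Δ N μ) (v : Node p q) :
    MemLp (fun ω => ∑ j : Subprocess p q, ∑ k ∈ Finset.Icc 1 v.2,
      M.theta Δ v.1 j k * N (j, v.2 - k) ω) 2 μ :=
  memLp_finsetSum _ fun _ _ => memLp_finsetSum _ fun _ _ => (hN.memLp _).const_mul _

variable [IsProbabilityMeasure μ]

lemma memLp_noise (hN : M.IsDiscretized Δ N μ) (v : Node p q) : MemLp (M.noise Δ N v) 2 μ :=
  ((hN.memLp v).sub (hN.memLp_lagSum v)).sub (memLp_const _)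

/-- The autoregressive equation, for covariances with a square integrable variable. -/
lemma covariance_eq (hN : M.IsDiscretized Δ N μ) (v : Node p q) {Y : Ω → ℝ}
    (hY : MemLp Y 2 μ) :
    cov[N v, Y; μ] = (∑ u ∈ Finset.univ ×ˢ Finset.range v.2,
      M.theta Δ v.1 u.1 (v.2 - u.2) * cov[N u, Y; μ]) + cov[M.noise Δ N v, Y; μ] := by
  have hnoise : cov[M.noise Δ N v, Y; μ] = cov[N v, Y; μ] -
      cov[fun ω => ∑ j : Subprocess p q, ∑ k ∈ Finset.Icc 1 v.2,
        M.theta Δ v.1 j k * N (j, v.2 - k) ω, Y; μ] := by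
    rw [← covariance_fun_sub_left (hN.memLp v) (hN.memLp_lagSum v) hY]
    exact covariance_sub_const_left
      (((hN.memLp v).sub (hN.memLp_lagSum v)).integrable (by norm_num)) _
  have hlag : cov[fun ω => ∑ j : Subprocess p q, ∑ k ∈ Finset.Icc 1 v.2,
        M.theta Δ v.1 j k * N (j, v.2 - k) ω, Y; μ] =
      ∑ u ∈ Finset.univ ×ˢ Finset.range v.2,
        M.theta Δ v.1 u.1 (v.2 - u.2) * cov[N u, Y; μ] := by
    rw [covariance_fun_sum_left
      (fun j => memLp_finsetSum _ fun k _ => (hN.memLp _).const_mul _) hY, Finset.sum_product]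
    refine Finset.sum_congr rfl fun j _ => ?_
    rw [covariance_fun_sum_left' (fun k _ => (hN.memLp _).const_mul _) hY]
    simp only [covariance_const_mul_left]
    refine Finset.sum_bij' (fun k _ => v.2 - k) (fun t _ => v.2 - t) ?_ ?_ ?_ ?_ ?_
    · intro k hk
      simp only [Finset.mem_Icc] at hk
      simp only [Finset.mem_range]
      omega
    · intro t ht
      simp only [Finset.mem_range] at ht
      simp only [Finset.mem_Icc]
      omega
    · intro k hk
      simp only [Finset.mem_Icc] at hk
      omega
    · intro t ht
      simp only [Finset.mem_range] at ht
      omega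
    · intro k hk
      simp only [Finset.mem_Icc] at hk
      simp only [Nat.sub_sub_self hk.2]
  rw [hnoise, hlag]
  ring

/-- The noise of a variable is uncorrelated with all other variables that are not later. -/
lemma covariance_noise_eq_zero (hN : M.IsDiscretized Δ N μ) {u : Node p q} (hu : 1 ≤ u.2) :
    ∀ v : Node p q, v.2 ≤ u.2 → v ≠ u → cov[N v, M.noise Δ N u; μ] = 0 := by
  suffices h : ∀ (t : ℕ) (v : Node p q), v.2 = t → v.2 ≤ u.2 → v ≠ u →
      cov[N v, M.noise Δ N u; μ] = 0 from fun v => h v.2 v rfl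
  intro t
  induction t using Nat.strong_induction_on with
  | _ t ih =>
    intro v hvt hvu hne
    rcases Nat.eq_zero_or_pos v.2 with h0 | hpos
    · obtain ⟨i, s⟩ := v
      simp only at h0
      subst h0
      exact covariance_eq_zero_of_ae_eq_zero (hN.initial i)
    -- Expanding `v` leaves only strictly earlier variables, covered by induction.
    · rw [hN.covariance_eq v (hN.memLp_noise u), hN.noise_uncorrelated v u hpos hu hne, add_zero]
      refine Finset.sum_eq_zero fun w hw => ?_
      have hw2 : w.2 < v.2 := Finset.mem_range.1 (Finset.mem_product.1 hw).2
      rw [ih w.2 (hvt ▸ hw2) w rfl (hw2.le.trans hvu), mul_zero]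
      rintro rfl
      omega

lemma covariance_noise_self (hN : M.IsDiscretized Δ N μ) {u : Node p q} (hu : 1 ≤ u.2) :
    cov[N u, M.noise Δ N u; μ] = Var[M.noise Δ N u; μ] := by
  rw [hN.covariance_eq u (hN.memLp_noise u),
    covariance_self (hN.memLp_noise u).aestronglyMeasurable.aemeasurable, Finset.sum_eq_zero,
    zero_add]
  intro w hw
  have hw2 : w.2 < u.2 := Finset.mem_range.1 (Finset.mem_product.1 hw).2
  rw [hN.covariance_noise_eq_zero hu w hw2.le, mul_zero]
  rintro rfl
  omega

/-- The covariance matrix of finitely many variables with positive times is nonsingular. -/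
lemma linearIndepOn_covariance (hN : M.IsDiscretized Δ N μ) (B : Finset (Node p q))
    (hB : ∀ u ∈ B, 1 ≤ u.2) :
    LinearIndepOn ℝ (fun (u : Node p q) (b : B) => cov[N u, N b; μ]) (B : Set (Node p q)) := by
  rw [linearIndepOn_finset_iff]
  intro c hc
  by_contra! hne
  -- For a latest variable in the relation, its noise is uncorrelated with every other term, even in
  -- the same bin, so pairing with it isolates `c x`.
  obtain ⟨x, hx, hmax⟩ := Finset.exists_max_image (B.filter fun u => c u ≠ 0) Prod.snd
    (by simpa [Finset.filter_nonempty_iff] using hne)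
  rw [Finset.mem_filter] at hx
  have hLp : ∀ u ∈ B, MemLp (fun ω => c u * N u ω) 2 μ := fun u _ => (hN.memLp u).const_mul _
  have hX : MemLp (fun ω => ∑ u ∈ B, c u * N u ω) 2 μ := memLp_finsetSum _ hLp
  have hcov : ∀ b ∈ B, cov[fun ω => ∑ u ∈ B, c u * N u ω, N b; μ] = 0 := by
    intro b hb
    rw [covariance_fun_sum_left' hLp (hN.memLp b)]
    have := congrFun hc ⟨b, hb⟩
    simpa [covariance_const_mul_left] using this
  -- The combination is uncorrelated with each of its own terms, hence with itself.
  have hvar : Var[fun ω => ∑ u ∈ B, c u * N u ω; μ] = 0 := by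
    rw [← covariance_self hX.aestronglyMeasurable.aemeasurable, covariance_fun_sum_right' hLp hX]
    refine Finset.sum_eq_zero fun b hb => ?_
    rw [covariance_const_mul_right, hcov b hb, mul_zero]
  have h0 := covariance_eq_zero_of_variance_eq_zero (Y := M.noise Δ N x) hX hvar
  have hx1 := hB x hx.1
  rw [covariance_fun_sum_left' hLp (hN.memLp_noise x), Finset.sum_eq_single_of_mem x hx.1,
    covariance_const_mul_left, hN.covariance_noise_self hx1] at h0
  · exact mul_ne_zero hx.2 (hN.noise_variance x hx1).ne' h0
  · intro u hu hux
    rw [covariance_const_mul_left]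
    by_cases hcu : c u = 0
    · rw [hcu, zero_mul]
    · rw [hN.covariance_noise_eq_zero hx1 u (hmax u (Finset.mem_filter.2 ⟨hu, hcu⟩)) hux, mul_zero]

/-- If all window graph parents are observed, the rank condition says that the lagged variables
contain them. -/
lemma rankCondition_iff (hN : M.IsDiscretized Δ N μ) {m n : ℕ} {o : Fin p}
    {P : Finset (Fin p)} (hm : M.EffectiveLagsLE Δ m) (hn : m < n)
    (hobs : ∀ u, M.WindowEdge Δ u (Sum.inl o, n) → ∃ i, u.1 = Sum.inl i) :
    RankCondition n m o N μ P ↔ ContainsWindowParents M Δ n m o P := by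
  classical
  set B := (obsVars p q n m).erase (Sum.inl o, n) with hBdef
  have htime : ∀ u ∈ B, 1 ≤ u.2 ∧ u.2 ≤ n := by
    intro u hu
    have := Finset.mem_Icc.1 (mem_obsVars.1 (Finset.mem_of_mem_erase hu)).2
    omega
  have hparB : ∀ u, M.WindowEdge Δ u (Sum.inl o, n) → u ∈ B := by
    intro u hu
    have ht := Finset.mem_Ico.1 (hu.time_mem hm)
    refine Finset.mem_erase.2 ⟨?_, mem_obsVars.2 ⟨hobs u hu, Finset.mem_Icc.2 ⟨ht.1, ht.2.le⟩⟩⟩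
    rintro rfl
    exact lt_irrefl _ ht.2
  have hSB : lagVars q n m P ⊆ B := lagVars_subset
  have hlin := hN.linearIndepOn_covariance B fun u hu => (htime u hu).1
  -- The guard matters for `u.2 = n`: `θ` at lag 0 integrates `φ` over negative times, where it is
  -- unconstrained.
  let c : Node p q → ℝ := fun u =>
    if M.WindowEdge Δ u (Sum.inl o, n) then M.theta Δ (Sum.inl o) u.1 (n - u.2) else 0
  have hc : ∀ u, c u ≠ 0 ↔ M.WindowEdge Δ u (Sum.inl o, n) := by
    intro u
    simp only [c, ne_eq, ite_eq_right_iff, Classical.not_imp]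
    exact ⟨fun h => h.1, fun h => ⟨h, h.2⟩⟩
  have hrow : (fun b : B => cov[N (Sum.inl o, n), N b; μ]) =
      ∑ u ∈ B, c u • fun b : B => cov[N u, N b; μ] := by
    funext b
    rw [Finset.sum_apply, hN.covariance_eq _ (hN.memLp b), covariance_comm (M.noise Δ N _),
      hN.covariance_noise_eq_zero (by simp only; omega) b (htime b b.2).2
        (Finset.ne_of_mem_erase b.2), add_zero]
    -- One sum runs over the whole past, latent variables included, the other over `B`; terms
    -- outside the intersection vanish because all parents lie in both.
    refine Finset.sum_congr_of_eq_on_inter ?_ ?_ ?_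
    · intro u hu huB
      have hθ : ¬ M.WindowEdge Δ u (Sum.inl o, n) := fun h => huB (hparB u h)
      have hlt : u.2 < n := Finset.mem_range.1 (Finset.mem_product.1 hu).2
      have : M.theta Δ (Sum.inl o) u.1 (n - u.2) = 0 := by
        by_contra h
        exact hθ ⟨hlt, h⟩
      simp only [this, zero_mul]
    · intro u _ hu
      have hθ : ¬ M.WindowEdge Δ u (Sum.inl o, n) := fun h =>
        hu (Finset.mem_product.2 ⟨Finset.mem_univ _, Finset.mem_range.2 h.1⟩)
      simp [c, hθ]
    · intro u hu _
      have hlt : u.2 < n := Finset.mem_range.1 (Finset.mem_product.1 hu).2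
      by_cases h : M.WindowEdge Δ u (Sum.inl o, n)
      · simp [c, h]
      · have : M.theta Δ (Sum.inl o) u.1 (n - u.2) = 0 := by
          by_contra h'
          exact h ⟨hlt, h'⟩
        simp [c, this]
  have hrank := rank_insert_eq_card_iff (fun (u : Node p q) (b : B) => cov[N u, N b; μ])
    (S := lagVars q n m P) (Sum.inl o, n) (hlin.mono (Finset.coe_subset.2 hSB))
  have hgoal : RankCondition n m o N μ P ↔ _ := hrank
  rw [hgoal, hrow, sum_smul_mem_span_image_iff hSB hlin c]
  exact ⟨fun h u hu => h u (hparB u hu) ((hc u).2 hu), fun h u _ hcu => h u ((hc u).1 hcu)⟩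

end Model.IsDiscretized

end Hawkes

theorem mainTheorem6 {p q : ℕ} (M : Hawkes.Model p q) (Δ : ℝ) (hΔ : 0 < Δ)
    (m n : ℕ) (hm : M.EffectiveLagsLE Δ m) (hn : m < n)
    {Ω : Type*} [MeasurableSpace Ω] (ℙ : MeasureTheory.Measure Ω)
    [MeasureTheory.IsProbabilityMeasure ℙ]
    (N : Hawkes.Node p q → Ω → ℝ) (hN : M.IsDiscretized Δ N ℙ)
    (o : Fin p) (P : Finset (Fin p)) :
    ((Hawkes.IsSummaryParentCauseSet M o P ↔
        Minimal (Hawkes.ContainsWindowParents M Δ n m o) P) ∧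
      (Hawkes.IsSummaryParentCauseSet M o P →
        Minimal (Hawkes.LagsDSeparate M Δ n m o) P ∧
        Minimal (Hawkes.RankCondition n m o N ℙ) P)) ∧
    ((∀ l : Fin q, ¬ M.SummaryEdge (Sum.inr l) (Sum.inl o)) →
      List.TFAE
        [Hawkes.IsSummaryParentCauseSet M o P,
          Minimal (Hawkes.ContainsWindowParents M Δ n m o) P,
          Minimal (Hawkes.LagsDSeparate M Δ n m o) P,
          Minimal (Hawkes.RankCondition n m o N ℙ) P]) := by
  have h12 := Hawkes.isSummaryParentCauseSet_iff (o := o) (P := P) hΔ hm hn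
  have hequiv : (∀ u, M.WindowEdge Δ u (Sum.inl o, n) → ∃ i, u.1 = Sum.inl i) →
      Hawkes.LagsDSeparate M Δ n m o = Hawkes.ContainsWindowParents M Δ n m o ∧
      Hawkes.RankCondition n m o N ℙ = Hawkes.ContainsWindowParents M Δ n m o := fun hobs =>
    ⟨funext fun _ => propext (Hawkes.lagsDSeparate_iff hm hobs),
      funext fun _ => propext (hN.rankCondition_iff hm hn hobs)⟩
  refine ⟨⟨h12, fun h1 => ?_⟩, fun hlat => ?_⟩
  · have h2 := h12.1 h1
    -- Statement (2) already forces every parent to be observed, so no assumption on latent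
    -- subprocesses is needed here.
    obtain ⟨h3, h4⟩ := hequiv fun u hu => by
      obtain ⟨⟨i, -, hi⟩, -⟩ := Hawkes.mem_lagVars.1 (h2.prop u hu)
      exact ⟨i, hi⟩
    rw [h3, h4]
    exact ⟨h2, h2⟩
  · obtain ⟨h3, h4⟩ := hequiv fun u hu => by
      obtain ⟨i | l, t⟩ := u
      · exact ⟨i, rfl⟩
      · exact absurd ((Hawkes.Model.summaryEdge_iff_windowEdge hΔ hm hn _ _).2 ⟨t, hu⟩) (hlat l)
    rw [h3, h4, h12]
    tfae_finish
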